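/- **Language.** Concepts of LE-$\mathcal{ALC}$ over a set of atomic concept names are $C ::= D \mid C_1\wedge C_2\mid C_1\vee C_2\mid \langle R_\Diamond\rangle C\mid [R_\Box]C$; we also write $\Diamond C,\Box C$ for the last two. Positive terms over object names $b$ and feature names $y$ are $bIy$, $bR_\Box y$, $yR_\Diamond b$, $b:C$, $y::C$; an ABox $\mathcal A$ is a set of positive terms and negated positive terms. A name occurs in $\mathcal A$ if some (possibly negated) term of $\mathcal A$ contains it; $C$ occurs in $\mathcal A$ (written $C\in\mathcal A$) if it is a subformula of a concept used in some (possibly negated) term of $\mathcal A$. **Semantics.** An interpretation consists of an enriched formal context $(A,X,I,R_\Box,R_\Diamond)$, with $I,R_\Box\subseteq A\times X$ and $R_\Diamond\subseteq X\times A$ such that all sets $\{a: aR_\Box x\}$, $\{x: aR_\Box x\}$, $\{x : xR_\Diamond a\}$, $\{a: xR_\Diamond a\}$ are Galois-stable in the polarity $(A,X,I)$, together with elements $b^{\mathcal M}\in A$, $y^{\mathcal M}\in X$ and formal concepts $D^{\mathcal M}$ of $(A,X,I)$. Compound concepts are interpreted in the concept lattice by meet, join, $\Box c=$ the concept with extent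 $\{a: aR_\Box x \text{ for all } x \text{ in the intent of } c\}$, and $\Diamond c=$ the concept with intent $\{x: xR_\Diamond a\text{ for all }a\text{ in the extent of }c\}$. Then $\mathcal M\models b:C$ (resp. $y::C$) iff $b^{\mathcal M}$ is in the extent (resp. $y^{\mathcal M}$ is in the intent) of $C^{\mathcal M}$; relational terms and negations are read as usual, and $\mathcal M\models C_1\sqsubseteq C_2$ iff $C_1^{\mathcal M}\le C_2^{\mathcal M}$. An ABox is consistent if it has a model, and $\mathcal A\models\varphi$ means that every model of $\mathcal A$ satisfies $\varphi$. **Tableaux completion.** $\overline{\mathcal A}$ is the least set that contains $\mathcal A$ and is closed under the following rules, which use additional names $a_C,\blacklozenge b,\Diamond b$ (objects) and $x_C,\Box y,\blacksquare y$ (features), all distinct and new except that $\Diamond a_C=a_{\Diamond C}$ and $\Box x_C=x_{\Box C}$: - for $C\in\mathcal A$: $a_C:C$ and $x_C::C$; - from $b:C$ and $y::C$: $bIy$; - from $b:C_1\wedge C_2$: $b:C_1$ and $b:C_2$; from $y::C_1\vee C_2$: $y::C_1$ and $y::C_2$; - from $b:\Box C$ and $y::C$: $bR_\Box y$; from $y::\Diamond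 C$ and $b:C$: $yR_\Diamond b$; - from $bI\Box y$ or from $\blacklozenge bIy$: $bR_\Box y$; from $\Diamond bIy$ or from $bI\blacksquare y$: $yR_\Diamond b$; - from $bR_\Box y$: $\blacklozenge bIy$ and $bI\Box y$; from $yR_\Diamond b$: $\Diamond bIy$ and $bI\blacksquare y$; - from $b:C_1$ and $b:C_2$, if $C_1\wedge C_2\in\mathcal A$: $b:C_1\wedge C_2$; from $y::C_1$ and $y::C_2$, if $C_1\vee C_2\in\mathcal A$: $y::C_1\vee C_2$; - from $\neg(b:C)$: $\neg(bIx_C)$; from $\neg(y::C)$: $\neg(a_CIy)$; - from $bIx_C$: $b:C$; from $a_CIy$: $y::C$. **Concept companions.** For an original name $b$ (resp. $y$), $con(b)$ (resp. $con(y)$) is interpreted in each $\mathcal M$ as the concept generated by $b^{\mathcal M}$ (resp. $y^{\mathcal M}$). Moreover $con(a_C)=con(x_C)=C$, $con(\Diamond b)=\Diamond con(b)$, $con(\blacklozenge b)=\blacklozenge con(b)$, $con(\Box y)=\Box con(y)$ and $con(\blacksquare y)=\blacksquare con(y)$, where $\blacklozenge$ is the left adjoint of $\Box$ and $\blacksquare$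 is the right adjoint of $\Diamond$. **Lemma.** Let $\mathcal A$ be a consistent LE-$\mathcal{ALC}$ ABox. For all object names $b$ and feature names $y$ occurring in $\overline{\mathcal A}$ and all concepts $C,C_1,C_2$ occurring in $\mathcal A$: 1. $\mathcal A\models con(b)\sqsubseteq con(y)$ iff $bIy\in\overline{\mathcal A}$; 2. $\mathcal A\models con(b)\sqsubseteq\Box con(y)$ iff $bR_\Box y\in\overline{\mathcal A}$; 3. $\mathcal A\models\Diamond con(b)\sqsubseteq con(y)$ iff $yR_\Diamond b\in\overline{\mathcal A}$; 4. $\mathcal A\models con(b)\sqsubseteq C$ iff $bIx_C\in\overline{\mathcal A}$; 5. $\mathcal A\models C\sqsubseteq con(y)$ iff $a_CIy\in\overline{\mathcal A}$; 6. $\mathcal A\models con(b)\sqsubseteq C$ iff $b:C\in\overline{\mathcal A}$; 7. $\mathcal A\models C\sqsubseteq con(y)$ iff $y::C\in\overline{\mathcal A}$; 8. $\mathcal A\models C_1\sqsubseteq C_2$ iff $a_{C_1}Ix_{C_2}\in\overline{\mathcal A}$. Consequently the tableau-generated model $\mathcal M$ is a universal model of $\mathcal A$ for positive relationship, membership and subsumption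 queries. Here the objects (features) of $\mathcal M$ are the object (feature) names occurring in $\overline{\mathcal A}$ together with one additional object (feature) that stands in no relation to anything; $I,R_\Box,R_\Diamond$ relate names exactly as in $\overline{\mathcal A}$; names occurring in $\overline{\mathcal A}$ denote themselves, and atomic concepts $D\in\mathcal A$ denote $(x_D^{\downarrow},a_D^{\uparrow})$; individual names (resp. atomic concepts) not occurring in $\mathcal A$ denote the additional points (resp. the least concept). That is, $\mathcal M$ is a model of $\mathcal A$, and for every query $q$ of the form $bIy$, $bR_\Box y$, $yR_\Diamond b$, $b:C$, $y::C$ or $C_1\sqsubseteq C_2$ whose individual names and concepts occur in $\mathcal A$, $\mathcal A\models q$ iff $\mathcal M\models q$. -/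

import Mathlib

universe u

namespace LEALC

/-! ### Syntax -/

/-- Concepts of LE-ALC over a set `At` of atomic concept names. -/
inductive Cpt (At : Type u) : Type u
  | atom (D : At)
  | meet (C₁ C₂ : Cpt At)
  | join (C₁ C₂ : Cpt At)
  | dia (C : Cpt At)
  | box (C : Cpt At)

/-- The set of sub-formulas of a concept. -/
def Cpt.sub {At : Type u} : Cpt At → Set (Cpt At)
  | .atom D => {.atom D}
  | .meet C₁ C₂ => {.meet C₁ C₂} ∪ (C₁.sub ∪ C₂.sub)
  | .join C₁ C₂ => {.join C₁ C₂} ∪ (C₁.sub ∪ C₂.sub)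
  | .dia C => {.dia C} ∪ C.sub
  | .box C => {.box C} ∪ C.sub

/-- Positive ABox terms over object names `O` and feature names `F`:
`b I y`, `b R_□ y`, `y R_◇ b`, `b : C` and `y :: C`. -/
inductive Term (O F At : Type u) : Type u
  | inc (b : O) (y : F)
  | rbox (b : O) (y : F)
  | rdia (y : F) (b : O)
  | mem (b : O) (C : Cpt At)
  | comem (y : F) (C : Cpt At)

/-- ABox assertions: positive terms and their negations. -/
inductive Assertion (O F At : Type u) : Type u
  | pos (t : Term O F At)
  | neg (t : Term O F At)

/-- An ABox is a set of assertions. -/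
abbrev ABox (O F At : Type u) := Set (Assertion O F At)

section Occurrence

variable {O F At : Type u}

def Assertion.term : Assertion O F At → Term O F At
  | .pos t => t
  | .neg t => t

/-- The object name `b` is used in the term. -/
def Term.HasObj (b : O) : Term O F At → Prop
  | .inc b' _ => b' = b
  | .rbox b' _ => b' = b
  | .rdia _ b' => b' = b
  | .mem b' _ => b' = b
  | .comem _ _ => False

/-- The feature name `y` is used in the term. -/
def Term.HasFeat (y : F) : Term O F At → Prop
  | .inc _ y' => y' = y
  | .rbox _ y' => y' = y
  | .rdia y' _ => y' = y
  | .mem _ _ => False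
  | .comem y' _ => y' = y

/-- `C` is a sub-formula of the concept used in the term. -/
def Term.HasCpt (C : Cpt At) : Term O F At → Prop
  | .mem _ C' => C ∈ C'.sub
  | .comem _ C' => C ∈ C'.sub
  | _ => False

def ABox.ObjOccurs (A : ABox O F At) (b : O) : Prop := ∃ α ∈ A, α.term.HasObj b

def ABox.FeatOccurs (A : ABox O F At) (y : F) : Prop := ∃ α ∈ A, α.term.HasFeat y

def ABox.CptOccurs (A : ABox O F At) (C : Cpt At) : Prop := ∃ α ∈ A, α.term.HasCpt C

end Occurrence

/-! ### Semantics -/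

/-- Enriched formal contexts: a polarity `(A, X, I)` with `I`-compatible relations
`R_□ ⊆ A × X` and `R_◇ ⊆ X × A`. -/
structure EnrichedContext : Type (u + 1) where
  A : Type u
  X : Type u
  I : A → X → Prop
  Rbox : A → X → Prop
  Rdia : X → A → Prop
  isExtent_rbox : ∀ x, Order.IsExtent I {a | Rbox a x}
  isIntent_rbox : ∀ a, Order.IsIntent I {x | Rbox a x}
  isIntent_rdia : ∀ a, Order.IsIntent I {x | Rdia x a}
  isExtent_rdia : ∀ x, Order.IsExtent I {a | Rdia x a}

namespace EnrichedContext

variable (𝔽 : EnrichedContext.{u})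

/-- The concept lattice of the underlying polarity. -/
abbrev Lat : Type u := Concept 𝔽.A 𝔽.X 𝔽.I

theorem isExtent_lowerPolar_rbox (t : Set 𝔽.X) :
    Order.IsExtent 𝔽.I (lowerPolar 𝔽.Rbox t) := by
  have h : lowerPolar 𝔽.Rbox t = ⋂ x ∈ t, {a | 𝔽.Rbox a x} := by
    ext a; simp [mem_lowerPolar_iff]
  rw [h]
  exact .iInter₂ _ fun x _ => 𝔽.isExtent_rbox x

theorem isIntent_upperPolar_rbox (s : Set 𝔽.A) :
    Order.IsIntent 𝔽.I (upperPolar 𝔽.Rbox s) := by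
  have h : upperPolar 𝔽.Rbox s = ⋂ a ∈ s, {x | 𝔽.Rbox a x} := by
    ext a; simp [mem_upperPolar_iff]
  rw [h]
  exact .iInter₂ _ fun a _ => 𝔽.isIntent_rbox a

theorem isIntent_lowerPolar_rdia (s : Set 𝔽.A) :
    Order.IsIntent 𝔽.I (lowerPolar 𝔽.Rdia s) := by
  have h : lowerPolar 𝔽.Rdia s = ⋂ a ∈ s, {x | 𝔽.Rdia x a} := by
    ext a; simp [mem_lowerPolar_iff]
  rw [h]
  exact .iInter₂ _ fun a _ => 𝔽.isIntent_rdia a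

theorem isExtent_upperPolar_rdia (t : Set 𝔽.X) :
    Order.IsExtent 𝔽.I (upperPolar 𝔽.Rdia t) := by
  have h : upperPolar 𝔽.Rdia t = ⋂ x ∈ t, {a | 𝔽.Rdia x a} := by
    ext a; simp [mem_upperPolar_iff]
  rw [h]
  exact .iInter₂ _ fun x _ => 𝔽.isExtent_rdia x

/-- `[R_□] c`, the concept with extent `R_□⁽⁰⁾[intent c]`. -/
def box (c : 𝔽.Lat) : 𝔽.Lat :=
  Concept.ofIsExtent 𝔽.I (lowerPolar 𝔽.Rbox c.intent) (𝔽.isExtent_lowerPolar_rbox _)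

/-- `⟨R_◇⟩ c`, the concept with intent `R_◇⁽⁰⁾[extent c]`. -/
def dia (c : 𝔽.Lat) : 𝔽.Lat :=
  Concept.ofIsIntent 𝔽.I (lowerPolar 𝔽.Rdia c.extent) (𝔽.isIntent_lowerPolar_rdia _)

/-- `⧫ c`, the left adjoint of `box` (see `gc_bdia_box`). -/
def bdia (c : 𝔽.Lat) : 𝔽.Lat :=
  Concept.ofIsIntent 𝔽.I (upperPolar 𝔽.Rbox c.extent) (𝔽.isIntent_upperPolar_rbox _)

/-- `■ c`, the right adjoint of `dia` (see `gc_dia_bbox`). -/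
def bbox (c : 𝔽.Lat) : 𝔽.Lat :=
  Concept.ofIsExtent 𝔽.I (upperPolar 𝔽.Rdia c.intent) (𝔽.isExtent_upperPolar_rdia _)

theorem gc_bdia_box : GaloisConnection 𝔽.bdia 𝔽.box := fun c d => by
  rw [← Concept.intent_subset_intent_iff, ← Concept.extent_subset_extent_iff]
  exact subset_upperPolar_iff_subset_lowerPolar

theorem gc_dia_bbox : GaloisConnection 𝔽.dia 𝔽.bbox := fun c d => by
  rw [← Concept.intent_subset_intent_iff, ← Concept.extent_subset_extent_iff]
  exact subset_upperPolar_iff_subset_lowerPolar.symm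

end EnrichedContext

/-- Interpretations of the language with object names `O`, feature names `F`, atoms `At`. -/
structure Interp (O F At : Type u) extends EnrichedContext.{u} where
  obj : O → A
  feat : F → X
  atom : At → Concept A X I

section Satisfaction

variable {O F At : Type u}

/-- The interpretation of a concept in the complex algebra. -/
def Interp.cpt (M : Interp O F At) : Cpt At → M.Lat
  | .atom D => M.atom D
  | .meet C₁ C₂ => M.cpt C₁ ⊓ M.cpt C₂
  | .join C₁ C₂ => M.cpt C₁ ⊔ M.cpt C₂
  | .dia C => M.dia (M.cpt C)
  | .box C => M.box (M.cpt C)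

def Interp.SatTerm (M : Interp O F At) : Term O F At → Prop
  | .inc b y => M.I (M.obj b) (M.feat y)
  | .rbox b y => M.Rbox (M.obj b) (M.feat y)
  | .rdia y b => M.Rdia (M.feat y) (M.obj b)
  | .mem b C => M.obj b ∈ (M.cpt C).extent
  | .comem y C => M.feat y ∈ (M.cpt C).intent

def Interp.Sat (M : Interp O F At) : Assertion O F At → Prop
  | .pos t => M.SatTerm t
  | .neg t => ¬ M.SatTerm t

/-- `M` is a model of the ABox `A`. -/
def Interp.Models (M : Interp O F At) (A : ABox O F At) : Prop := ∀ α ∈ A, M.Sat α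

/-- An ABox is consistent if it has a model. -/
def ABox.Consistent (A : ABox O F At) : Prop := ∃ M : Interp.{u} O F At, M.Models A

end Satisfaction

/-! ### The tableaux completion -/

/-- Object names of the tableaux: the original ones, the classifying objects `a_C`, and the
names `◇b`, `⧫b`. As `◇a_C` is the name `a_{◇C}`, the name `◇b` is written `ObjName.dia b`,
never with the constructor `rawDia` directly. -/
inductive ObjName (O At : Type u) : Type u
  | base (b : O)
  | cls (C : Cpt At)
  | rawDia (b : ObjName O At)
  | bdia (b : ObjName O At)

/-- Feature names of the tableaux: the original ones, the classifying features `x_C`, and the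
names `□y`, `■y`. As `□x_C` is the name `x_{□C}`, the name `□y` is written `FeatName.box y`,
never with the constructor `rawBox` directly. -/
inductive FeatName (F At : Type u) : Type u
  | base (y : F)
  | cls (C : Cpt At)
  | rawBox (y : FeatName F At)
  | bbox (y : FeatName F At)

section Tableau

variable {O F At : Type u}

/-- The name `◇b`, where `◇a_C` is `a_{◇C}`. -/
def ObjName.dia : ObjName O At → ObjName O At
  | .cls C => .cls (.dia C)
  | b => .rawDia b

/-- The name `□y`, where `□x_C` is `x_{□C}`. -/
def FeatName.box : FeatName F At → FeatName F At
  | .cls C => .cls (.box C)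
  | y => .rawBox y

/-- An original term, read over the names of the tableaux. -/
def Term.embed : Term O F At → Term (ObjName O At) (FeatName F At) At
  | .inc b y => .inc (.base b) (.base y)
  | .rbox b y => .rbox (.base b) (.base y)
  | .rdia y b => .rdia (.base y) (.base b)
  | .mem b C => .mem (.base b) C
  | .comem y C => .comem (.base y) C

def Assertion.embed : Assertion O F At → Assertion (ObjName O At) (FeatName F At) At
  | .pos t => .pos t.embed
  | .neg t => .neg t.embed

/-- The assertions obtained from the ABox `A` by applying the tableaux expansion rules. -/
inductive Derivable (A : ABox O F At) :
    Assertion (ObjName O At) (FeatName F At) At → Prop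
  | init {α} : α ∈ A → Derivable A α.embed
  -- creation rule
  | create_obj {C} : A.CptOccurs C → Derivable A (.pos (.mem (.cls C) C))
  | create_feat {C} : A.CptOccurs C → Derivable A (.pos (.comem (.cls C) C))
  -- basic rule
  | basic {b y C} : Derivable A (.pos (.mem b C)) → Derivable A (.pos (.comem y C)) →
      Derivable A (.pos (.inc b y))
  -- rules for the logical connectives
  | meet_left {b C₁ C₂} : Derivable A (.pos (.mem b (.meet C₁ C₂))) →
      Derivable A (.pos (.mem b C₁))
  | meet_right {b C₁ C₂} : Derivable A (.pos (.mem b (.meet C₁ C₂))) →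
      Derivable A (.pos (.mem b C₂))
  | join_left {y C₁ C₂} : Derivable A (.pos (.comem y (.join C₁ C₂))) →
      Derivable A (.pos (.comem y C₁))
  | join_right {y C₁ C₂} : Derivable A (.pos (.comem y (.join C₁ C₂))) →
      Derivable A (.pos (.comem y C₂))
  | box {b y C} : Derivable A (.pos (.mem b (.box C))) → Derivable A (.pos (.comem y C)) →
      Derivable A (.pos (.rbox b y))
  | dia {b y C} : Derivable A (.pos (.comem y (.dia C))) → Derivable A (.pos (.mem b C)) →
      Derivable A (.pos (.rdia y b))
  -- `I`-compatibility rules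
  | compat_box {b y} : Derivable A (.pos (.inc b (FeatName.box y))) →
      Derivable A (.pos (.rbox b y))
  | compat_bbox {b y} : Derivable A (.pos (.inc b (.bbox y))) →
      Derivable A (.pos (.rdia y b))
  | compat_dia {b y} : Derivable A (.pos (.inc (ObjName.dia b) y)) →
      Derivable A (.pos (.rdia y b))
  | compat_bdia {b y} : Derivable A (.pos (.inc (.bdia b) y)) →
      Derivable A (.pos (.rbox b y))
  -- inverse rules for connectives
  | meet_inv {b C₁ C₂} : Derivable A (.pos (.mem b C₁)) → Derivable A (.pos (.mem b C₂)) →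
      A.CptOccurs (.meet C₁ C₂) → Derivable A (.pos (.mem b (.meet C₁ C₂)))
  | join_inv {y C₁ C₂} : Derivable A (.pos (.comem y C₁)) → Derivable A (.pos (.comem y C₂)) →
      A.CptOccurs (.join C₁ C₂) → Derivable A (.pos (.comem y (.join C₁ C₂)))
  -- adjunction rules
  | adj_bdia {b y} : Derivable A (.pos (.rbox b y)) → Derivable A (.pos (.inc (.bdia b) y))
  | adj_box {b y} : Derivable A (.pos (.rbox b y)) →
      Derivable A (.pos (.inc b (FeatName.box y)))
  | adj_dia {b y} : Derivable A (.pos (.rdia y b)) →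
      Derivable A (.pos (.inc (ObjName.dia b) y))
  | adj_bbox {b y} : Derivable A (.pos (.rdia y b)) → Derivable A (.pos (.inc b (.bbox y)))
  -- basic rules for negative assertions
  | neg_obj {b C} : Derivable A (.neg (.mem b C)) → Derivable A (.neg (.inc b (.cls C)))
  | neg_feat {y C} : Derivable A (.neg (.comem y C)) → Derivable A (.neg (.inc (.cls C) y))
  -- appending rules
  | append_feat {b C} : Derivable A (.pos (.inc b (.cls C))) → Derivable A (.pos (.mem b C))
  | append_obj {y C} : Derivable A (.pos (.inc (.cls C) y)) → Derivable A (.pos (.comem y C))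

/-- The tableaux completion of the ABox `A`. -/
def completion (A : ABox O F At) : ABox (ObjName O At) (FeatName F At) At :=
  {α | Derivable A α}

end Tableau

/-! ### Concept companions and entailment -/

/-- Concepts extended with the concepts generated by individuals and with the adjoint
operators, as needed to express concept companions. -/
inductive ExtCpt (O F At : Type u) : Type u
  | of (C : Cpt At)
  | genObj (b : O)
  | genFeat (y : F)
  | box (c : ExtCpt O F At)
  | dia (c : ExtCpt O F At)
  | bbox (c : ExtCpt O F At)
  | bdia (c : ExtCpt O F At)

section Companion

variable {O F At : Type u}

def Interp.ext (M : Interp O F At) : ExtCpt O F At → M.Lat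
  | .of C => M.cpt C
  | .genObj b => Concept.ofObject M.I (M.obj b)
  | .genFeat y => Concept.ofAttribute M.I (M.feat y)
  | .box c => M.box (M.ext c)
  | .dia c => M.dia (M.ext c)
  | .bbox c => M.bbox (M.ext c)
  | .bdia c => M.bdia (M.ext c)

/-- The concept companion of an object name. -/
def conObj : ObjName O At → ExtCpt O F At
  | .base b => .genObj b
  | .cls C => .of C
  | .rawDia b => .dia (conObj b)
  | .bdia b => .bdia (conObj b)

/-- The concept companion of a feature name. -/
def conFeat : FeatName F At → ExtCpt O F At
  | .base y => .genFeat y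
  | .cls C => .of C
  | .rawBox y => .box (conFeat y)
  | .bbox y => .bbox (conFeat y)

/-- `A ⊨ c ⊑ d`. -/
def ABox.EntailsSub (A : ABox O F At) (c d : ExtCpt O F At) : Prop :=
  ∀ M : Interp.{u} O F At, M.Models A → M.ext c ≤ M.ext d

/-! ### Positive queries and universal models -/

/-- Boolean relationship queries (`b I y`, `b R_□ y`, `y R_◇ b`) and membership queries
(`b : C`, `y :: C`), both given by positive terms, and subsumption queries `C₁ ⊑ C₂`. -/
inductive Query (O F At : Type u) : Type u
  | term (t : Term O F At)
  | subsumption (C₁ C₂ : Cpt At)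

def Interp.SatQuery (M : Interp O F At) : Query O F At → Prop
  | .term t => M.SatTerm t
  | .subsumption C₁ C₂ => M.cpt C₁ ≤ M.cpt C₂

/-- All individuals and concepts of the query occur in `A`. -/
def Query.Over (A : ABox O F At) : Query O F At → Prop
  | .term t => (∀ b, t.HasObj b → A.ObjOccurs b) ∧ (∀ y, t.HasFeat y → A.FeatOccurs y) ∧
      ∀ C, t.HasCpt C → A.CptOccurs C
  | .subsumption C₁ C₂ => A.CptOccurs C₁ ∧ A.CptOccurs C₂

def ABox.EntailsQuery (A : ABox O F At) (q : Query O F At) : Prop :=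
  ∀ M : Interp.{u} O F At, M.Models A → M.SatQuery q

/-- `M` is a universal model of `A` for positive relationship, membership and subsumption
queries. -/
def IsUniversalModel (A : ABox O F At) (M : Interp.{u} O F At) : Prop :=
  M.Models A ∧ ∀ q : Query O F At, q.Over A → (A.EntailsQuery q ↔ M.SatQuery q)

/-! ### The tableau-generated model -/

/-- The object names occurring in the completion, and one further object `none`. -/
abbrev TObj (A : ABox O F At) : Type u :=
  Option {b : ObjName O At // (completion A).ObjOccurs b}

/-- The feature names occurring in the completion, and one further feature `none`. -/
abbrev TFeat (A : ABox O F At) : Type u :=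
  Option {y : FeatName F At // (completion A).FeatOccurs y}

open Classical in
/-- The element with a given name, if the name occurs in the completion. -/
noncomputable def TObj.elem (A : ABox O F At) (b : ObjName O At) : TObj A :=
  if h : (completion A).ObjOccurs b then some ⟨b, h⟩ else none

open Classical in
noncomputable def TFeat.elem (A : ABox O F At) (y : FeatName F At) : TFeat A :=
  if h : (completion A).FeatOccurs y then some ⟨y, h⟩ else none

/-- `b I y` is in the completion; `none` is isolated. -/
def TI (A : ABox O F At) : TObj A → TFeat A → Prop
  | some b, some y => .pos (.inc b.1 y.1) ∈ completion A
  | _, _ => False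

def TRbox (A : ABox O F At) : TObj A → TFeat A → Prop
  | some b, some y => .pos (.rbox b.1 y.1) ∈ completion A
  | _, _ => False

def TRdia (A : ABox O F At) : TFeat A → TObj A → Prop
  | some y, some b => .pos (.rdia y.1 b.1) ∈ completion A
  | _, _ => False

theorem TI_elem_right (A : ABox O F At) (b) (y : FeatName F At) :
    TI A (some b) (TFeat.elem A y) ↔ .pos (.inc b.1 y) ∈ completion A := by
  unfold TFeat.elem
  split_ifs with h
  · exact Iff.rfl
  · exact ⟨False.elim, fun h' => h ⟨_, h', rfl⟩⟩

theorem TI_elem_left (A : ABox O F At) (b : ObjName O At) (y) :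
    TI A (TObj.elem A b) (some y) ↔ .pos (.inc b y.1) ∈ completion A := by
  unfold TObj.elem
  split_ifs with h
  · exact Iff.rfl
  · exact ⟨False.elim, fun h' => h ⟨_, h', rfl⟩⟩

theorem not_TI_none_left (A : ABox O F At) (y) : ¬ TI A none y := by
  cases y <;> exact id

theorem not_TI_none_right (A : ABox O F At) (b) : ¬ TI A b none := by
  cases b <;> exact id

/-- The enriched formal context generated by the tableaux completion, with one isolated object
and one isolated feature added. -/
abbrev tableauContext (A : ABox O F At) : EnrichedContext.{u} where
  A := TObj A
  X := TFeat A
  I := TI A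
  Rbox := TRbox A
  Rdia := TRdia A
  isExtent_rbox x := by
    refine ⟨{x.elim none fun y => TFeat.elem A (FeatName.box y.1)}, ?_⟩
    ext b
    rw [mem_lowerPolar_singleton]
    rcases x with _ | y
    · rcases b with _ | b <;> exact Iff.rfl
    · rcases b with _ | b
      · exact ⟨fun h => not_TI_none_left A _ h, False.elim⟩
      · exact (TI_elem_right A b _).trans ⟨.compat_box, .adj_box⟩
  isIntent_rbox a := by
    refine ⟨{a.elim none fun b => TObj.elem A (.bdia b.1)}, ?_⟩
    ext y
    rw [mem_upperPolar_singleton]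
    rcases a with _ | b
    · rcases y with _ | y <;> exact Iff.rfl
    · rcases y with _ | y
      · exact ⟨fun h => not_TI_none_right A _ h, False.elim⟩
      · exact (TI_elem_left A _ y).trans ⟨.compat_bdia, .adj_bdia⟩
  isIntent_rdia a := by
    refine ⟨{a.elim none fun b => TObj.elem A (ObjName.dia b.1)}, ?_⟩
    ext y
    rw [mem_upperPolar_singleton]
    rcases a with _ | b
    · rcases y with _ | y <;> exact Iff.rfl
    · rcases y with _ | y
      · exact ⟨fun h => not_TI_none_right A _ h, False.elim⟩
      · exact (TI_elem_left A _ y).trans ⟨.compat_dia, .adj_dia⟩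
  isExtent_rdia x := by
    refine ⟨{x.elim none fun y => TFeat.elem A (.bbox y.1)}, ?_⟩
    ext b
    rw [mem_lowerPolar_singleton]
    rcases x with _ | y
    · rcases b with _ | b <;> exact Iff.rfl
    · rcases b with _ | b
      · exact ⟨fun h => not_TI_none_left A _ h, False.elim⟩
      · exact (TI_elem_right A b _).trans ⟨.compat_bbox, .adj_bbox⟩

/-- For a concept occurring in `A`, the pair `(x_C↓, a_C↑)` is a formal concept. -/
def tableauConcept (A : ABox O F At) (C : Cpt At) (hC : A.CptOccurs C) :
    Concept (TObj A) (TFeat A) (TI A) where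
  extent := lowerPolar (TI A) {TFeat.elem A (.cls C)}
  intent := upperPolar (TI A) {TObj.elem A (.cls C)}
  upperPolar_extent := by
    have hinc : .pos (.inc (.cls C) (.cls C)) ∈ completion A :=
      .basic (.create_obj hC) (.create_feat hC)
    have ho : (completion A).ObjOccurs (.cls C) := ⟨_, hinc, rfl⟩
    ext y
    rw [mem_upperPolar_singleton]
    constructor
    · intro h
      refine h ?_
      rw [mem_lowerPolar_singleton, TObj.elem, dif_pos ho, TI_elem_right]
      exact hinc
    · intro h b hb
      rw [mem_lowerPolar_singleton] at hb
      rcases y with _ | y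
      · exact (not_TI_none_right A _ h).elim
      rcases b with _ | b
      · exact (not_TI_none_left A _ hb).elim
      rw [TI_elem_left] at h
      rw [TI_elem_right] at hb
      exact .basic (.append_feat hb) (.append_obj h)
  lowerPolar_intent := by
    have hinc : .pos (.inc (.cls C) (.cls C)) ∈ completion A :=
      .basic (.create_obj hC) (.create_feat hC)
    have hf : (completion A).FeatOccurs (.cls C) := ⟨_, hinc, rfl⟩
    ext b
    rw [mem_lowerPolar_singleton]
    constructor
    · intro h
      refine h ?_
      rw [mem_upperPolar_singleton, TFeat.elem, dif_pos hf, TI_elem_left]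
      exact hinc
    · intro hb y h
      rw [mem_upperPolar_singleton] at h
      rcases y with _ | y
      · exact (not_TI_none_right A _ h).elim
      rcases b with _ | b
      · exact (not_TI_none_left A _ hb).elim
      rw [TI_elem_left] at h
      rw [TI_elem_right] at hb
      exact .basic (.append_feat hb) (.append_obj h)

open Classical in
/-- The tableau-generated model: names that occur in the completion denote themselves, and an
atomic concept `D` that occurs in `A` denotes `(x_D↓, a_D↑)`. Individual names and atomic
concepts that do not occur denote the isolated point and the least concept, respectively. -/
noncomputable abbrev tableauModel (A : ABox O F At) : Interp.{u} O F At where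
  toEnrichedContext := tableauContext A
  obj b := TObj.elem A (.base b)
  feat y := TFeat.elem A (.base y)
  atom D := if h : A.CptOccurs (.atom D) then tableauConcept A _ h else
    (⊥ : Concept (TObj A) (TFeat A) (TI A))

end Companion

end LEALC

/-! Read every positive term over tableau names as a subsumption between concept companions
(`Interp.Subsumes`).

Soundness (`Derivable.subsumes`): in any model of `A`, each rule becomes a lattice inequality. The
basic rule is transitivity, the inverse rules are the universal properties of meet and join, and the
adjunction and compatibility rules are the two Galois connections.

Completeness needs only one model, the tableau-generated one. There the adjunction and compatibility
rules make the operators send the concept generated by a name to the concept generated by the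
corresponding new name. Together with the rules for meet and join, this gives a truth lemma
(`cpt_tableauModel`): each `C` in `A` denotes the concept generated both by `a_C` and by `x_C`.
Hence the companion of every generated name denotes the concept that the name itself generates, and
subsumption in this model is derivability (`subsumes_tableauModel_iff`).

Consistency enters only to show that this model satisfies the negated assertions: if one failed, its
positive part would be derivable, hence by soundness true in the given model of `A`. -/

namespace LEALC

/-! ### Modal operators on concepts generated by a single point. -/

namespace EnrichedContext

variable (𝔽 : EnrichedContext.{u})

/-- The extent of the concept generated by `a` is the Galois closure of `{a}`, and `{a | Rdia x a}`
is Galois-stable, so it contains the closure as soon as it contains `a`. The next three lemmas use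
the other stability conditions in the same way. -/
theorem intent_dia_ofObject (a : 𝔽.A) :
    (𝔽.dia (Concept.ofObject 𝔽.I a)).intent = {x | 𝔽.Rdia x a} := by
  ext x
  refine ⟨fun h => h (subset_lowerPolar_upperPolar 𝔽.I {a} rfl), fun h => ?_⟩
  exact (𝔽.isExtent_rdia x).lowerPolar_upperPolar_subset (Set.singleton_subset_iff.2 h)

theorem intent_bdia_ofObject (a : 𝔽.A) :
    (𝔽.bdia (Concept.ofObject 𝔽.I a)).intent = {x | 𝔽.Rbox a x} := by
  ext x
  refine ⟨fun h => h (subset_lowerPolar_upperPolar 𝔽.I {a} rfl), fun h => ?_⟩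
  exact (𝔽.isExtent_rbox x).lowerPolar_upperPolar_subset (Set.singleton_subset_iff.2 h)

theorem extent_box_ofAttribute (x : 𝔽.X) :
    (𝔽.box (Concept.ofAttribute 𝔽.I x)).extent = {a | 𝔽.Rbox a x} := by
  ext a
  refine ⟨fun h => h (subset_upperPolar_lowerPolar 𝔽.I {x} rfl), fun h => ?_⟩
  exact (𝔽.isIntent_rbox a).upperPolar_lowerPolar_subset (Set.singleton_subset_iff.2 h)

theorem extent_bbox_ofAttribute (x : 𝔽.X) :
    (𝔽.bbox (Concept.ofAttribute 𝔽.I x)).extent = {a | 𝔽.Rdia x a} := by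
  ext a
  refine ⟨fun h => h (subset_upperPolar_lowerPolar 𝔽.I {x} rfl), fun h => ?_⟩
  exact (𝔽.isIntent_rdia a).upperPolar_lowerPolar_subset (Set.singleton_subset_iff.2 h)

theorem ofObject_le_box_ofAttribute_iff {a : 𝔽.A} {x : 𝔽.X} :
    Concept.ofObject 𝔽.I a ≤ 𝔽.box (Concept.ofAttribute 𝔽.I x) ↔ 𝔽.Rbox a x := by
  rw [Concept.ofObjects_le_iff, extent_box_ofAttribute, Set.singleton_subset_iff]
  exact Iff.rfl

theorem dia_ofObject_le_ofAttribute_iff {a : 𝔽.A} {x : 𝔽.X} :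
    𝔽.dia (Concept.ofObject 𝔽.I a) ≤ Concept.ofAttribute 𝔽.I x ↔ 𝔽.Rdia x a := by
  rw [Concept.le_ofAttributes_iff, intent_dia_ofObject, Set.singleton_subset_iff]
  exact Iff.rfl

end EnrichedContext

/-! ### Subformulas. -/

section

variable {O F At : Type u}

theorem Cpt.self_mem_sub (C : Cpt At) : C ∈ C.sub := by
  cases C <;> simp [Cpt.sub]

theorem Cpt.sub_subset_of_mem {C D : Cpt At} (h : C ∈ D.sub) : C.sub ⊆ D.sub := by
  have aux {E : Cpt At} {s : Set (Cpt At)} (hE : E.sub = {E} ∪ s)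
      (hs : C ∈ s → C.sub ⊆ s) (h : C ∈ E.sub) : C.sub ⊆ E.sub := by
    rw [hE] at h
    rcases h with rfl | h
    · exact subset_rfl
    · exact hE ▸ (hs h).trans Set.subset_union_right
  induction D with
  | atom D => rw [Set.mem_singleton_iff.1 h]
  | meet D₁ D₂ ih₁ ih₂ =>
    exact aux rfl (Or.rec (fun h => (ih₁ h).trans Set.subset_union_left)
      fun h => (ih₂ h).trans Set.subset_union_right) h
  | join D₁ D₂ ih₁ ih₂ =>
    exact aux rfl (Or.rec (fun h => (ih₁ h).trans Set.subset_union_left)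
      fun h => (ih₂ h).trans Set.subset_union_right) h
  | dia D ih => exact aux rfl ih h
  | box D ih => exact aux rfl ih h

/-- Lets inductions on concepts stay among those occurring in `A`, the only ones with creation and
inverse rules. -/
theorem ABox.CptOccurs.mono {A : ABox O F At} {C D : Cpt At} (hD : A.CptOccurs D)
    (h : C ∈ D.sub) : A.CptOccurs C := by
  obtain ⟨α, hα, hC⟩ := hD
  refine ⟨α, hα, ?_⟩
  revert hC
  cases α.term <;> first | exact id | exact fun hC => Cpt.sub_subset_of_mem hC h

/-! ### Soundness of the tableaux rules -/

/-- The subsumption between concept companions expressed by a positive term. -/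
def Interp.Subsumes (M : Interp O F At) : Term (ObjName O At) (FeatName F At) At → Prop
  | .inc b y => M.ext (conObj b) ≤ M.ext (conFeat y)
  | .rbox b y => M.ext (conObj b) ≤ M.box (M.ext (conFeat y))
  | .rdia y b => M.dia (M.ext (conObj b)) ≤ M.ext (conFeat y)
  | .mem b C => M.ext (conObj b) ≤ M.cpt C
  | .comem y C => M.cpt C ≤ M.ext (conFeat y)

-- The identification of `◇a_C` with `a_{◇C}` is harmless, as both readings have the same companion
-- up to interpretation.
@[simp]
theorem Interp.ext_conObj_dia (M : Interp O F At) (b : ObjName O At) :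
    M.ext (conObj b.dia) = M.dia (M.ext (conObj b)) := by
  cases b <;> rfl

@[simp]
theorem Interp.ext_conFeat_box (M : Interp O F At) (y : FeatName F At) :
    M.ext (conFeat y.box) = M.box (M.ext (conFeat y)) := by
  cases y <;> rfl

/-- Original names have generated concepts as companions, so on original terms the subsumption
reading is plain satisfaction. The relational cases rest on Galois stability. -/
theorem Interp.subsumes_embed_iff (M : Interp O F At) (t : Term O F At) :
    M.Subsumes t.embed ↔ M.SatTerm t := by
  cases t with
  | inc b y => exact Concept.ofObject_le_ofAttribute_iff
  | rbox b y => exact M.ofObject_le_box_ofAttribute_iff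
  | rdia y b => exact M.dia_ofObject_le_ofAttribute_iff
  | mem b C => exact Concept.ofObjects_le_iff.trans Set.singleton_subset_iff
  | comem y C => exact Concept.le_ofAttributes_iff.trans Set.singleton_subset_iff

theorem Derivable.subsumes {A : ABox O F At} {M : Interp.{u} O F At} (hM : M.Models A)
    {t : Term (ObjName O At) (FeatName F At) At} (ht : Derivable A (.pos t)) :
    M.Subsumes t := by
  generalize hα : Assertion.pos t = α at ht
  induction ht generalizing t with
  | init h =>
    rename_i α
    rcases α with s | s
    · cases hα
      exact (M.subsumes_embed_iff s).2 (hM _ h)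
    · cases hα
  | create_obj | create_feat => cases hα; exact le_rfl
  | basic _ _ ih₁ ih₂ => cases hα; exact (ih₁ rfl).trans (ih₂ rfl)
  | meet_left _ ih => cases hα; exact (ih rfl).trans inf_le_left
  | meet_right _ ih => cases hα; exact (ih rfl).trans inf_le_right
  | join_left _ ih => cases hα; exact le_sup_left.trans (ih rfl)
  | join_right _ ih => cases hα; exact le_sup_right.trans (ih rfl)
  | box _ _ ih₁ ih₂ => cases hα; exact (ih₁ rfl).trans (M.gc_bdia_box.monotone_u (ih₂ rfl))
  | dia _ _ ih₁ ih₂ => cases hα; exact (M.gc_dia_bbox.monotone_l (ih₂ rfl)).trans (ih₁ rfl)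
  | compat_box _ ih => cases hα; exact (ih rfl).trans_eq (M.ext_conFeat_box _)
  | compat_bbox _ ih => cases hα; exact (M.gc_dia_bbox _ _).2 (ih rfl)
  | compat_dia _ ih => cases hα; exact (M.ext_conObj_dia _).symm.trans_le (ih rfl)
  | compat_bdia _ ih => cases hα; exact (M.gc_bdia_box _ _).1 (ih rfl)
  | meet_inv _ _ _ ih₁ ih₂ => cases hα; exact le_inf (ih₁ rfl) (ih₂ rfl)
  | join_inv _ _ _ ih₁ ih₂ => cases hα; exact sup_le (ih₁ rfl) (ih₂ rfl)
  | adj_bdia _ ih => cases hα; exact (M.gc_bdia_box _ _).2 (ih rfl)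
  | adj_box _ ih => cases hα; exact (ih rfl).trans_eq (M.ext_conFeat_box _).symm
  | adj_dia _ ih => cases hα; exact (M.ext_conObj_dia _).trans_le (ih rfl)
  | adj_bbox _ ih => cases hα; exact (M.gc_dia_bbox _ _).1 (ih rfl)
  | neg_obj | neg_feat => cases hα
  -- The companion of `x_C` is `C` itself, so premise and conclusion of an appending rule are the
  -- same inequality.
  | @append_feat b C _ ih => cases hα; exact ih (t := .inc b (.cls C)) rfl
  | @append_obj y C _ ih => cases hα; exact ih (t := .inc (.cls C) y) rfl

/-! ### Names generated by the tableaux rules -/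

/-- The object names that can be generated from the ABox `A`. -/
inductive ObjName.Generated (A : ABox O F At) : ObjName O At → Prop
  | base (b) : Generated A (.base b)
  | cls {C} : A.CptOccurs C → Generated A (.cls C)
  | dia {b} : Generated A b → Generated A b.dia
  | bdia {b} : Generated A b → Generated A (.bdia b)

/-- The feature names that can be generated from the ABox `A`. -/
inductive FeatName.Generated (A : ABox O F At) : FeatName F At → Prop
  | base (y) : Generated A (.base y)
  | cls {C} : A.CptOccurs C → Generated A (.cls C)
  | box {y} : Generated A y → Generated A y.box
  | bbox {y} : Generated A y → Generated A (.bbox y)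

theorem ObjName.dia_injective : Function.Injective (ObjName.dia (O := O) (At := At)) := by
  rintro (_ | _ | _ | _) (_ | _ | _ | _) h <;> cases h <;> rfl

theorem FeatName.box_injective : Function.Injective (FeatName.box (F := F) (At := At)) := by
  rintro (_ | _ | _ | _) (_ | _ | _ | _) h <;> cases h <;> rfl

/-- Needed because the compatibility rules strip an operator from a name. If the name is some
`a_{◇C}` with `◇C` in `A`, then `C` is in `A` as a subformula, so `a_C` is generated too. -/
theorem ObjName.Generated.of_dia {A : ABox O F At} {b : ObjName O At}
    (h : b.dia.Generated A) : b.Generated A := by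
  generalize hb : b.dia = b' at h
  cases h with
  | base => cases b <;> cases hb
  | cls hC =>
    cases b <;> cases hb
    exact .cls (hC.mono (.inr (Cpt.self_mem_sub _)))
  | dia h => exact ObjName.dia_injective hb ▸ h
  | bdia => cases b <;> cases hb

theorem ObjName.Generated.of_bdia {A : ABox O F At} {b : ObjName O At}
    (h : (ObjName.bdia b).Generated A) : b.Generated A := by
  generalize hb : ObjName.bdia b = b' at h
  cases h with
  | base | cls => cases hb
  | @dia b' => cases b' <;> cases hb
  | bdia h => cases hb; exact h

theorem FeatName.Generated.of_box {A : ABox O F At} {y : FeatName F At}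
    (h : y.box.Generated A) : y.Generated A := by
  generalize hy : y.box = y' at h
  cases h with
  | base => cases y <;> cases hy
  | cls hC =>
    cases y <;> cases hy
    exact .cls (hC.mono (.inr (Cpt.self_mem_sub _)))
  | box h => exact FeatName.box_injective hy ▸ h
  | bbox => cases y <;> cases hy

theorem FeatName.Generated.of_bbox {A : ABox O F At} {y : FeatName F At}
    (h : (FeatName.bbox y).Generated A) : y.Generated A := by
  generalize hy : FeatName.bbox y = y' at h
  cases h with
  | base | cls => cases hy
  | @box y' => cases y' <;> cases hy
  | bbox h => cases hy; exact h

/-- All names of a term are generated from the ABox `A`. -/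
def Term.Generated (A : ABox O F At) : Term (ObjName O At) (FeatName F At) At → Prop
  | .inc b y => b.Generated A ∧ y.Generated A
  | .rbox b y => b.Generated A ∧ y.Generated A
  | .rdia y b => b.Generated A ∧ y.Generated A
  | .mem b _ => b.Generated A
  | .comem y _ => y.Generated A

theorem Term.generated_embed (A : ABox O F At) (t : Term O F At) : t.embed.Generated A := by
  cases t <;> first | exact ⟨.base _, .base _⟩ | exact .base _

/-- A negated membership can only come from `A` itself, since the negative rules conclude negated
incidences. So the names `x_C` and `a_C` introduced by these rules have `C` in `A`. -/
theorem Derivable.cptOccurs_of_neg {A : ABox O F At}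
    {t : Term (ObjName O At) (FeatName F At) At} (h : Derivable A (.neg t)) {C : Cpt At}
    (hC : t.HasCpt C) : A.CptOccurs C := by
  generalize hα : Assertion.neg t = α at h
  cases h with
  | init h =>
    rename_i α
    refine ⟨α, h, ?_⟩
    rcases α with s | s
    · cases hα
    · cases hα
      cases s <;> exact hC
  | neg_obj => cases hα; exact hC.elim
  | neg_feat => cases hα; exact hC.elim
  | _ => cases hα

theorem Derivable.generated {A : ABox O F At}
    {α : Assertion (ObjName O At) (FeatName F At) At} (h : Derivable A α) :
    α.term.Generated A := by
  induction h with
  | init h =>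
    rename_i α
    cases α <;> exact Term.generated_embed A _
  | create_obj h | create_feat h => exact .cls h
  | basic _ _ ih₁ ih₂ | box _ _ ih₁ ih₂ => exact ⟨ih₁, ih₂⟩
  | dia _ _ ih₁ ih₂ => exact ⟨ih₂, ih₁⟩
  | meet_left _ ih | meet_right _ ih | join_left _ ih | join_right _ ih => exact ih
  | compat_box _ ih => exact ⟨ih.1, ih.2.of_box⟩
  | compat_bbox _ ih => exact ⟨ih.1, ih.2.of_bbox⟩
  | compat_dia _ ih => exact ⟨ih.1.of_dia, ih.2⟩
  | compat_bdia _ ih => exact ⟨ih.1.of_bdia, ih.2⟩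
  | meet_inv _ _ _ ih | join_inv _ _ _ ih => exact ih
  | adj_bdia _ ih => exact ⟨.bdia ih.1, ih.2⟩
  | adj_box _ ih => exact ⟨ih.1, .box ih.2⟩
  | adj_dia _ ih => exact ⟨.dia ih.1, ih.2⟩
  | adj_bbox _ ih => exact ⟨ih.1, .bbox ih.2⟩
  | neg_obj h ih => exact ⟨ih, .cls (h.cptOccurs_of_neg (Cpt.self_mem_sub _))⟩
  | neg_feat h ih => exact ⟨.cls (h.cptOccurs_of_neg (Cpt.self_mem_sub _)), ih⟩
  | append_feat _ ih => exact ih.1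
  | append_obj _ ih => exact ih.2

theorem generated_of_objOccurs {A : ABox O F At} {b : ObjName O At}
    (h : (completion A).ObjOccurs b) : b.Generated A := by
  obtain ⟨α, hα, hb⟩ := h
  have := Derivable.generated hα
  revert this hb
  cases α.term <;> rintro ⟨⟩ h <;> first | exact h | exact h.1

theorem generated_of_featOccurs {A : ABox O F At} {y : FeatName F At}
    (h : (completion A).FeatOccurs y) : y.Generated A := by
  obtain ⟨α, hα, hy⟩ := h
  have := Derivable.generated hα
  revert this hy
  cases α.term <;> rintro ⟨⟩ h <;> first | exact h | exact h.2

/-! ### The tableau-generated model -/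

variable (A : ABox O F At)

/-- Names that do not occur are sent to the isolated point and appear in no derivable term, so no
occurrence hypothesis is required. -/
theorem TI_elem (b : ObjName O At) (y : FeatName F At) :
    TI A (TObj.elem A b) (TFeat.elem A y) ↔ Derivable A (.pos (.inc b y)) := by
  by_cases h : (completion A).FeatOccurs y
  · rw [TFeat.elem, dif_pos h]
    exact TI_elem_left A b _
  · rw [TFeat.elem, dif_neg h]
    exact ⟨fun h' => (not_TI_none_right A _ h').elim, fun h' => (h ⟨_, h', rfl⟩).elim⟩

theorem TRbox_elem (b : ObjName O At) (y : FeatName F At) :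
    TRbox A (TObj.elem A b) (TFeat.elem A y) ↔ Derivable A (.pos (.rbox b y)) := by
  unfold TObj.elem TFeat.elem
  split_ifs with h₁ h₂ h₂
  · exact Iff.rfl
  · exact ⟨False.elim, fun h' => h₂ ⟨_, h', rfl⟩⟩
  all_goals exact ⟨False.elim, fun h' => h₁ ⟨_, h', rfl⟩⟩

theorem TRdia_elem (y : FeatName F At) (b : ObjName O At) :
    TRdia A (TFeat.elem A y) (TObj.elem A b) ↔ Derivable A (.pos (.rdia y b)) := by
  unfold TObj.elem TFeat.elem
  split_ifs with h₁ h₂ h₂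
  · exact Iff.rfl
  · exact ⟨False.elim, fun h' => h₂ ⟨_, h', rfl⟩⟩
  all_goals exact ⟨False.elim, fun h' => h₁ ⟨_, h', rfl⟩⟩

variable {A}

theorem TObj.elem_coe (b : {b : ObjName O At // (completion A).ObjOccurs b}) :
    TObj.elem A b.1 = some b := dif_pos b.2

theorem TFeat.elem_coe (y : {y : FeatName F At // (completion A).FeatOccurs y}) :
    TFeat.elem A y.1 = some y := dif_pos y.2

theorem setOf_eq_of_elem_left {p q : TObj A → Prop} (hp : ¬ p none) (hq : ¬ q none)
    (h : ∀ b, p (TObj.elem A b) ↔ q (TObj.elem A b)) : {a | p a} = {a | q a} := by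
  ext (_ | b)
  · exact iff_of_false hp hq
  · rw [← TObj.elem_coe]
    exact h _

theorem setOf_eq_of_elem_right {p q : TFeat A → Prop} (hp : ¬ p none) (hq : ¬ q none)
    (h : ∀ y, p (TFeat.elem A y) ↔ q (TFeat.elem A y)) : {x | p x} = {x | q x} := by
  ext (_ | y)
  · exact iff_of_false hp hq
  · rw [← TFeat.elem_coe]
    exact h _

theorem not_TRbox_none_left (x) : ¬ TRbox A none x := by cases x <;> exact id

theorem not_TRbox_none_right (a) : ¬ TRbox A a none := by cases a <;> exact id

theorem not_TRdia_none_left (a) : ¬ TRdia A none a := by cases a <;> exact id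

theorem not_TRdia_none_right (x) : ¬ TRdia A x none := by cases x <;> exact id

/-- The adjunction rule and the compatibility rule for `□y` are converse to each other; the next
three lemmas use the pairs for `⧫b`, `◇b` and `■y`. -/
theorem setOf_TRbox_left (y : FeatName F At) :
    {a | TRbox A a (TFeat.elem A y)} = {a | TI A a (TFeat.elem A y.box)} := by
  refine setOf_eq_of_elem_left (not_TRbox_none_left _) (not_TI_none_left A _) fun b => ?_
  rw [TRbox_elem, TI_elem]
  exact ⟨.adj_box, .compat_box⟩

theorem setOf_TRbox_right (b : ObjName O At) :
    {x | TRbox A (TObj.elem A b) x} = {x | TI A (TObj.elem A (.bdia b)) x} := by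
  refine setOf_eq_of_elem_right (not_TRbox_none_right _) (not_TI_none_right A _) fun y => ?_
  rw [TRbox_elem, TI_elem]
  exact ⟨.adj_bdia, .compat_bdia⟩

theorem setOf_TRdia_left (b : ObjName O At) :
    {x | TRdia A x (TObj.elem A b)} = {x | TI A (TObj.elem A b.dia) x} := by
  refine setOf_eq_of_elem_right (not_TRdia_none_left _) (not_TI_none_right A _) fun y => ?_
  rw [TRdia_elem, TI_elem]
  exact ⟨.adj_dia, .compat_dia⟩

theorem setOf_TRdia_right (y : FeatName F At) :
    {a | TRdia A (TFeat.elem A y) a} = {a | TI A a (TFeat.elem A (.bbox y))} := by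
  refine setOf_eq_of_elem_left (not_TRdia_none_right _) (not_TI_none_left A _) fun b => ?_
  rw [TRdia_elem, TI_elem]
  exact ⟨.adj_bbox, .compat_bbox⟩

/-! ### Generated concepts in the tableau context and the truth lemma. -/

theorem intent_ofObject_eq (a : TObj A) :
    (Concept.ofObject (TI A) a).intent = {x | TI A a x} :=
  Set.ext fun _ => mem_upperPolar_singleton _

theorem extent_ofAttribute_eq (x : TFeat A) :
    (Concept.ofAttribute (TI A) x).extent = {a | TI A a x} :=
  Set.ext fun _ => mem_lowerPolar_singleton _

theorem dia_ofObject_elem (b : ObjName O At) :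
    (tableauContext A).dia (Concept.ofObject (TI A) (TObj.elem A b)) =
      Concept.ofObject (TI A) (TObj.elem A b.dia) :=
  Concept.ext' <| ((tableauContext A).intent_dia_ofObject _).trans <|
    (setOf_TRdia_left b).trans (intent_ofObject_eq _).symm

theorem bdia_ofObject_elem (b : ObjName O At) :
    (tableauContext A).bdia (Concept.ofObject (TI A) (TObj.elem A b)) =
      Concept.ofObject (TI A) (TObj.elem A (.bdia b)) :=
  Concept.ext' <| ((tableauContext A).intent_bdia_ofObject _).trans <|
    (setOf_TRbox_right b).trans (intent_ofObject_eq _).symm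

theorem box_ofAttribute_elem (y : FeatName F At) :
    (tableauContext A).box (Concept.ofAttribute (TI A) (TFeat.elem A y)) =
      Concept.ofAttribute (TI A) (TFeat.elem A y.box) :=
  Concept.ext <| ((tableauContext A).extent_box_ofAttribute _).trans <|
    (setOf_TRbox_left y).trans (extent_ofAttribute_eq _).symm

theorem bbox_ofAttribute_elem (y : FeatName F At) :
    (tableauContext A).bbox (Concept.ofAttribute (TI A) (TFeat.elem A y)) =
      Concept.ofAttribute (TI A) (TFeat.elem A (.bbox y)) :=
  Concept.ext <| ((tableauContext A).extent_bbox_ofAttribute _).trans <|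
    (setOf_TRdia_right y).trans (extent_ofAttribute_eq _).symm

/-- With the next lemma, gives one concept two generators: `x_C` suits meet and box, which are
computed on extents, while `a_C` suits join and diamond, which are computed on intents. -/
theorem ofAttribute_elem_cls {C : Cpt At} (hC : A.CptOccurs C) :
    Concept.ofAttribute (TI A) (TFeat.elem A (.cls C)) = tableauConcept A C hC :=
  Concept.ext rfl

theorem ofObject_elem_cls {C : Cpt At} (hC : A.CptOccurs C) :
    Concept.ofObject (TI A) (TObj.elem A (.cls C)) = tableauConcept A C hC :=
  Concept.ext' rfl

theorem derivable_mem_iff {b : ObjName O At} {C : Cpt At} (hC : A.CptOccurs C) :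
    Derivable A (.pos (.mem b C)) ↔ Derivable A (.pos (.inc b (.cls C))) :=
  ⟨fun h => .basic h (.create_feat hC), .append_feat⟩

theorem derivable_comem_iff {y : FeatName F At} {C : Cpt At} (hC : A.CptOccurs C) :
    Derivable A (.pos (.comem y C)) ↔ Derivable A (.pos (.inc (.cls C) y)) :=
  ⟨fun h => .basic (.create_obj hC) h, .append_obj⟩

/-- Comparing extents, this is the meet rule in one direction and its inverse rule in the other,
once incidence with `x_C` is traded for membership in `C`. -/
theorem ofAttribute_elem_meet {C₁ C₂ : Cpt At} (h : A.CptOccurs (.meet C₁ C₂))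
    (h₁ : A.CptOccurs C₁) (h₂ : A.CptOccurs C₂) :
    Concept.ofAttribute (TI A) (TFeat.elem A (.cls (.meet C₁ C₂))) =
      Concept.ofAttribute (TI A) (TFeat.elem A (.cls C₁)) ⊓
        Concept.ofAttribute (TI A) (TFeat.elem A (.cls C₂)) := by
  apply Concept.ext
  rw [Concept.extent_inf]
  simp only [extent_ofAttribute_eq]
  rw [← Set.ofPred_and]
  refine setOf_eq_of_elem_left (not_TI_none_left A _) (fun h => not_TI_none_left A _ h.1)
    fun b => ?_
  simp only [TI_elem, ← derivable_mem_iff, h, h₁, h₂]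
  exact ⟨fun hb => ⟨hb.meet_left, hb.meet_right⟩, fun hb => .meet_inv hb.1 hb.2 h⟩

theorem ofObject_elem_join {C₁ C₂ : Cpt At} (h : A.CptOccurs (.join C₁ C₂))
    (h₁ : A.CptOccurs C₁) (h₂ : A.CptOccurs C₂) :
    Concept.ofObject (TI A) (TObj.elem A (.cls (.join C₁ C₂))) =
      Concept.ofObject (TI A) (TObj.elem A (.cls C₁)) ⊔
        Concept.ofObject (TI A) (TObj.elem A (.cls C₂)) := by
  apply Concept.ext'
  rw [Concept.intent_sup]
  simp only [intent_ofObject_eq]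
  rw [← Set.ofPred_and]
  refine setOf_eq_of_elem_right (not_TI_none_right A _) (fun h => not_TI_none_right A _ h.1)
    fun y => ?_
  simp only [TI_elem, ← derivable_comem_iff, h, h₁, h₂]
  exact ⟨fun hy => ⟨hy.join_left, hy.join_right⟩, fun hy => .join_inv hy.1 hy.2 h⟩

theorem cpt_tableauModel {C : Cpt At} (hC : A.CptOccurs C) :
    (tableauModel A).cpt C = tableauConcept A C hC := by
  induction C with
  | atom D => exact dif_pos hC
  | meet C₁ C₂ ih₁ ih₂ =>
    have h₁ : A.CptOccurs C₁ := hC.mono (.inr (.inl C₁.self_mem_sub))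
    have h₂ : A.CptOccurs C₂ := hC.mono (.inr (.inr C₂.self_mem_sub))
    rw [Interp.cpt, ih₁ h₁, ih₂ h₂]
    simp only [← ofAttribute_elem_cls]
    exact (ofAttribute_elem_meet hC h₁ h₂).symm
  | join C₁ C₂ ih₁ ih₂ =>
    have h₁ : A.CptOccurs C₁ := hC.mono (.inr (.inl C₁.self_mem_sub))
    have h₂ : A.CptOccurs C₂ := hC.mono (.inr (.inr C₂.self_mem_sub))
    rw [Interp.cpt, ih₁ h₁, ih₂ h₂]
    simp only [← ofObject_elem_cls]
    exact (ofObject_elem_join hC h₁ h₂).symm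
  | dia C ih =>
    rw [Interp.cpt, ih (hC.mono (.inr C.self_mem_sub))]
    simp only [← ofObject_elem_cls]
    exact dia_ofObject_elem _
  | box C ih =>
    rw [Interp.cpt, ih (hC.mono (.inr C.self_mem_sub))]
    simp only [← ofAttribute_elem_cls]
    exact box_ofAttribute_elem _

/-- The induction is on generation rather than on the shape of the name: `a_{◇C}` may arise as
`◇a_C` although `◇C` is not in `A`, and then the truth lemma is available for `C` only. -/
theorem ext_conObj_tableauModel {b : ObjName O At} (hb : b.Generated A) :
    (tableauModel A).ext (conObj b) = Concept.ofObject (TI A) (TObj.elem A b) := by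
  induction hb with
  | base => rfl
  | cls hC => exact (cpt_tableauModel hC).trans (ofObject_elem_cls hC).symm
  | dia _ ih => rw [Interp.ext_conObj_dia, ih]; exact dia_ofObject_elem _
  | bdia _ ih => rw [conObj, Interp.ext, ih]; exact bdia_ofObject_elem _

theorem ext_conFeat_tableauModel {y : FeatName F At} (hy : y.Generated A) :
    (tableauModel A).ext (conFeat y) = Concept.ofAttribute (TI A) (TFeat.elem A y) := by
  induction hy with
  | base => rfl
  | cls hC => exact (cpt_tableauModel hC).trans (ofAttribute_elem_cls hC).symm
  | box _ ih => rw [Interp.ext_conFeat_box, ih]; exact box_ofAttribute_elem _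
  | bbox _ ih => rw [conFeat, Interp.ext, ih]; exact bbox_ofAttribute_elem _

theorem subsumes_tableauModel_iff {t : Term (ObjName O At) (FeatName F At) At}
    (ht : t.Generated A) (hC : ∀ C, t.HasCpt C → A.CptOccurs C) :
    (tableauModel A).Subsumes t ↔ Derivable A (.pos t) := by
  cases t with
  | inc b y =>
    rw [Interp.Subsumes, ext_conObj_tableauModel ht.1, ext_conFeat_tableauModel ht.2, ← TI_elem]
    exact Concept.ofObject_le_ofAttribute_iff
  | rbox b y =>
    rw [Interp.Subsumes, ext_conObj_tableauModel ht.1, ext_conFeat_tableauModel ht.2,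
      ← TRbox_elem]
    exact (tableauContext A).ofObject_le_box_ofAttribute_iff
  | rdia y b =>
    rw [Interp.Subsumes, ext_conObj_tableauModel ht.1, ext_conFeat_tableauModel ht.2,
      ← TRdia_elem]
    exact (tableauContext A).dia_ofObject_le_ofAttribute_iff
  | mem b C =>
    have hC := hC C C.self_mem_sub
    rw [Interp.Subsumes, ext_conObj_tableauModel ht, cpt_tableauModel hC,
      ← ofAttribute_elem_cls, derivable_mem_iff hC, ← TI_elem]
    exact Concept.ofObject_le_ofAttribute_iff
  | comem y C =>
    have hC := hC C C.self_mem_sub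
    rw [Interp.Subsumes, ext_conFeat_tableauModel ht, cpt_tableauModel hC,
      ← ofObject_elem_cls, derivable_comem_iff hC, ← TI_elem]
    exact Concept.ofObject_le_ofAttribute_iff

/-! ### The tableau model as a universal model. -/

theorem satTerm_tableauModel_iff {t : Term O F At} (hC : ∀ C, t.HasCpt C → A.CptOccurs C) :
    (tableauModel A).SatTerm t ↔ Derivable A (.pos t.embed) := by
  rw [← Interp.subsumes_embed_iff]
  exact subsumes_tableauModel_iff (t.generated_embed A) (by cases t <;> exact hC)

theorem models_tableauModel (hA : A.Consistent) : (tableauModel A).Models A := by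
  obtain ⟨M, hM⟩ := hA
  intro α hα
  have hC : ∀ C, α.term.HasCpt C → A.CptOccurs C := fun C hC => ⟨α, hα, hC⟩
  cases α with
  | pos t => exact (satTerm_tableauModel_iff hC).2 (.init hα)
  | neg t =>
    intro h
    -- Truth in the tableau model gives derivability, and soundness carries the term to `M`, which
    -- satisfies its negation.
    exact hM _ hα ((M.subsumes_embed_iff t).1 (((satTerm_tableauModel_iff hC).1 h).subsumes hM))

theorem forall_subsumes_iff (hA : A.Consistent) {t : Term (ObjName O At) (FeatName F At) At}
    (ht : t.Generated A) (hC : ∀ C, t.HasCpt C → A.CptOccurs C) :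
    (∀ M : Interp.{u} O F At, M.Models A → M.Subsumes t) ↔ Derivable A (.pos t) :=
  ⟨fun h => (subsumes_tableauModel_iff ht hC).1 (h _ (models_tableauModel hA)),
    fun h _ hM => h.subsumes hM⟩

theorem isUniversalModel_tableauModel (hA : A.Consistent) :
    IsUniversalModel A (tableauModel A) := by
  refine ⟨models_tableauModel hA, fun q hq => ⟨fun h => h _ (models_tableauModel hA), ?_⟩⟩
  intro h M hM
  cases q with
  | term t =>
    exact (M.subsumes_embed_iff t).1 (((satTerm_tableauModel_iff hq.2.2).1 h).subsumes hM)
  | subsumption C₁ C₂ =>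
    -- A subsumption query is the incidence of `a_{C₁}` with `x_{C₂}`, whose companions are `C₁` and
    -- `C₂`.
    have hgen : (Term.inc (.cls C₁) (.cls C₂) :
        Term (ObjName O At) (FeatName F At) At).Generated A := ⟨.cls hq.1, .cls hq.2⟩
    exact ((subsumes_tableauModel_iff hgen fun _ => False.elim).1 h).subsumes hM

end

end LEALC

open LEALC in
theorem mainTheorem1 {O F At : Type u} (A : ABox O F At) (hA : A.Consistent) :
    (∀ b y, (completion A).ObjOccurs b → (completion A).FeatOccurs y →
      (A.EntailsSub (conObj b) (conFeat y) ↔ .pos (.inc b y) ∈ completion A) ∧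
      (A.EntailsSub (conObj b) (.box (conFeat y)) ↔ .pos (.rbox b y) ∈ completion A) ∧
      (A.EntailsSub (.dia (conObj b)) (conFeat y) ↔ .pos (.rdia y b) ∈ completion A)) ∧
    (∀ b C, (completion A).ObjOccurs b → A.CptOccurs C →
      (A.EntailsSub (conObj b) (.of C) ↔ .pos (.inc b (.cls C)) ∈ completion A) ∧
      (A.EntailsSub (conObj b) (.of C) ↔ .pos (.mem b C) ∈ completion A)) ∧
    (∀ y C, (completion A).FeatOccurs y → A.CptOccurs C →
      (A.EntailsSub (.of C) (conFeat y) ↔ .pos (.inc (.cls C) y) ∈ completion A) ∧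
      (A.EntailsSub (.of C) (conFeat y) ↔ .pos (.comem y C) ∈ completion A)) ∧
    (∀ C₁ C₂, A.CptOccurs C₁ → A.CptOccurs C₂ →
      (A.EntailsSub (.of C₁) (.of C₂) ↔
        .pos (.inc (.cls C₁) (.cls C₂)) ∈ completion A)) ∧
    IsUniversalModel A (tableauModel A) := by
  -- Assuming generation rather than occurrence lets `a_C` and `x_C` be substituted directly, so
  -- this one equivalence yields every incidence clause.
  have inc {b y} (hb : ObjName.Generated A b) (hy : FeatName.Generated A y) :
      A.EntailsSub (conObj b) (conFeat y) ↔ .pos (.inc b y) ∈ completion A :=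
    forall_subsumes_iff (t := .inc b y) hA ⟨hb, hy⟩ fun _ => False.elim
  refine ⟨fun b y hb hy => ?_, fun b C hb hC => ?_, fun y C hy hC => ?_,
    fun C₁ C₂ h₁ h₂ => inc (.cls h₁) (.cls h₂), isUniversalModel_tableauModel hA⟩
  · have hb := generated_of_objOccurs hb
    have hy := generated_of_featOccurs hy
    exact ⟨inc hb hy, forall_subsumes_iff (t := .rbox b y) hA ⟨hb, hy⟩ fun _ => False.elim,
      forall_subsumes_iff (t := .rdia y b) hA ⟨hb, hy⟩ fun _ => False.elim⟩
  · have h := inc (generated_of_objOccurs hb) (.cls hC)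
    exact ⟨h, h.trans (derivable_mem_iff hC).symm⟩
  · have h := inc (.cls hC) (generated_of_featOccurs hy)
    exact ⟨h, h.trans (derivable_comem_iff hC).symm⟩
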